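/- Let $H\in(\tfrac12,1)$, let $(\beta^H(t))_{t\ge 0}$ be a real-valued fractional Brownian motion with Hurst index $H$ (a centered Gaussian process with continuous paths and covariance $\tfrac12(s^{2H}+t^{2H}-|t-s|^{2H})$), and let $(B(t))_{t\ge 0}$ be a standard real-valued Brownian motion independent of $\beta^H$, both defined on a probability space $(\Omega,\mathcal F,\mathbb P)$. Let $\mathcal F^H=\sigma\{\beta^H(t);\,t\ge 0\}$ and $\mathbb E^H[\cdot]=\mathbb E[\cdot\,|\,\mathcal F^H]$. Let $g:\mathbb R^2\to\mathbb R$ be of class $\mathcal C^3$ with bounded derivatives of order $1,2,3$, let $\overline g(x)=\int g(x,m)\,d\nu(m)$ with $\nu=\mathcal N(0,1)$, and let $x_0\in\mathbb R$. Let $T\in(0,\infty)$ and let the time-step size be $\Delta t=T/N$ with $N\in\mathbb N$, $N\ge 1$. Set $t_n=n\Delta t$, $\delta\beta_n^H=\beta^H(t_{n+1})-\beta^H(t_n)$ and $\gamma_n=\Delta t^{-1/2}\bigl(B(t_{n+1})-B(t_n)\bigr)$. Define the limiting scheme by $$X_{n+1}^0=X_n^0+g(X_n^0,\gamma_n)\,\delta\beta_n^H,\qquad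 X_0^0=x_0,$$ and the Euler scheme for the averaged equation $d\overline X(t)=\overline g(\overline X(t))\,d\beta^H(t)$ by $$\overline X_{n+1}=\overline X_n+\overline g(\overline X_n)\,\delta\beta_n^H,\qquad \overline X_0=x_0.$$ Then, for every $\varphi:\mathbb R\to\mathbb R$ of class $\mathcal C_b^3$ (three times continuously differentiable, bounded, with bounded derivatives of order $1,2,3$), $$\lim_{\Delta t\to 0}\ \mathbb E\Bigl[\bigl|\mathbb E^H[\varphi(X_N^0)]-\varphi(\overline X_N)\bigr|\Bigr]=0,$$ where $\Delta t\to 0$ along $\Delta t=T/N$, that is, $N\to\infty$. -/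

import Mathlib

open MeasureTheory ProbabilityTheory Filter Topology
open scoped NNReal

noncomputable section

namespace FBMAveraging

/-- Fractional Brownian motion with Hurst index `H`: a centered Gaussian process, with covariance
`(s ^ (2H) + t ^ (2H) - |t - s| ^ (2H)) / 2` and almost surely continuous paths. -/
structure IsFractionalBrownian {Ω : Type*} [MeasurableSpace Ω] (H : ℝ) (β : ℝ≥0 → Ω → ℝ)
    (P : Measure Ω) : Prop where
  measurable : ∀ t, Measurable (β t)
  gaussian : IsGaussianProcess β P
  centered : ∀ t, ∫ ω, β t ω ∂P = 0
  covariance_eq : ∀ s t : ℝ≥0, covariance (β s) (β t) P =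
    ((s : ℝ) ^ (2 * H) + (t : ℝ) ^ (2 * H) - |(t : ℝ) - s| ^ (2 * H)) / 2
  cont : ∀ᵐ ω ∂P, Continuous (fun t => β t ω)

/-- The `σ`-field `σ{β(t) ; t ≥ 0}` generated by a real-valued process. -/
abbrev generatedSigma {Ω : Type*} (β : ℝ≥0 → Ω → ℝ) : MeasurableSpace Ω :=
  ⨆ t, MeasurableSpace.comap (β t) inferInstance

/-- Real functions of class `C_b^K`: bounded, `K` times continuously differentiable, with bounded
derivatives of order `1, …, K`. -/
def IsCb (K : ℕ) (φ : ℝ → ℝ) : Prop :=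
  ContDiff ℝ K φ ∧ ∀ k ≤ K, ∃ C : ℝ, ∀ x, |iteratedDeriv k φ x| ≤ C

/-- Functions on the plane of class `C^3`, with bounded derivatives of order `1, 2, 3`
(the function itself need not be bounded). -/
def IsAdmissibleCoeff (g : ℝ × ℝ → ℝ) : Prop :=
  ContDiff ℝ 3 g ∧ ∀ k : ℕ, 1 ≤ k → k ≤ 3 → ∃ C : ℝ, ∀ z, ‖iteratedFDeriv ℝ k g z‖ ≤ C

/-- The averaged coefficient: the second variable is integrated against the standard Gaussian
distribution. -/
def averagedCoeff (g : ℝ × ℝ → ℝ) (x : ℝ) : ℝ :=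
  ∫ m, g (x, m) ∂(gaussianReal 0 1)

/-- The increment over the `n`-th time step of size `Δt`. -/
def increment {Ω : Type*} (Y : ℝ≥0 → Ω → ℝ) (Δt : ℝ≥0) (n : ℕ) (ω : Ω) : ℝ :=
  Y ((n + 1) * Δt) ω - Y (n * Δt) ω

/-- The normalized Brownian increment `γ_n = Δt ^ (-1/2) * (B (t_{n+1}) - B (t_n))`. -/
def normalizedIncrement {Ω : Type*} (B : ℝ≥0 → Ω → ℝ) (Δt : ℝ≥0) (n : ℕ) (ω : Ω) : ℝ :=
  (√(Δt : ℝ))⁻¹ * increment B Δt n ω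

/-- The limiting scheme `X_{n+1} = X_n + g (X_n, γ_n) δβ_n`, `X_0 = x₀`. -/
def limitScheme {Ω : Type*} (g : ℝ × ℝ → ℝ) (β B : ℝ≥0 → Ω → ℝ) (x₀ : ℝ) (Δt : ℝ≥0) :
    ℕ → Ω → ℝ
  | 0, _ => x₀
  | n + 1, ω => limitScheme g β B x₀ Δt n ω +
      g (limitScheme g β B x₀ Δt n ω, normalizedIncrement B Δt n ω) * increment β Δt n ω

/-- The Euler scheme for the averaged equation. -/
def averagedScheme {Ω : Type*} (g : ℝ × ℝ → ℝ) (β : ℝ≥0 → Ω → ℝ) (x₀ : ℝ) (Δt : ℝ≥0) :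
    ℕ → Ω → ℝ
  | 0, _ => x₀
  | n + 1, ω => averagedScheme g β x₀ Δt n ω +
      averagedCoeff g (averagedScheme g β x₀ Δt n ω) * increment β Δt n ω

end FBMAveraging

end

/-!
Freeze a path of `β`, and let `ψ x` be the integral curve of the averaged coefficient that starts
from `x`. Both schemes, driven by the values `b n` of the path on the grid, shadow
`ψ x₀ (b n - b 0)`. In one step, averaging over the noise makes `h (x + g (x, γ) * δb)` agree with
`h (ψ x δb)` to first order, which leaves an error of order `δb ^ 2` with a weight linear in `x`.
Summed along the flow, these errors bound the weak error by a multiple of `∑ δb ^ 2`, the quadratic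
variation of the path, whose mean `N * (T / N) ^ (2 * H)` tends to `0` because `2 * H > 1`. As `B`
is independent of `β`, conditioning on `β` freezes its path, and the pathwise bound passes to the
expectation by bounded convergence along subsequences.
-/

noncomputable section

namespace FBMAveraging

/-! ### Grönwall's inequality in both time directions -/

theorem gronwallBound_le_mul_exp {δ K ε x : ℝ} (hK : 0 ≤ K) (hε : 0 ≤ ε) :
    gronwallBound δ K ε x ≤ (δ + ε * x) * Real.exp (K * x) := by
  rcases hK.eq_or_lt with rfl | hK
  · simp [gronwallBound_K0]
  · have hexp : Real.exp (K * x) - 1 ≤ K * x * Real.exp (K * x) := by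
      have h := mul_le_mul_of_nonneg_right (Real.add_one_le_exp (-(K * x)))
        (Real.exp_pos (K * x)).le
      rw [← Real.exp_add, neg_add_cancel, Real.exp_zero] at h
      linarith
    calc gronwallBound δ K ε x
        = δ * Real.exp (K * x) + ε / K * (Real.exp (K * x) - 1) :=
          congrFun (gronwallBound_of_K_ne_0 hK.ne') x
      _ ≤ δ * Real.exp (K * x) + ε / K * (K * x * Real.exp (K * x)) := by gcongr
      _ = (δ + ε * x) * Real.exp (K * x) := by field_simp

section Gronwall

variable {E : Type*} [NormedAddCommGroup E] [NormedSpace ℝ E] {f f' : ℝ → E} {K ε t : ℝ}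

theorem norm_le_of_norm_deriv_le_of_nonneg (hK : 0 ≤ K) (hε : 0 ≤ ε) (ht : 0 ≤ t)
    (hf : ∀ r, HasDerivAt f (f' r) r) (hb : ∀ r ∈ Set.Icc 0 t, ‖f' r‖ ≤ K * ‖f r‖ + ε) :
    ‖f t‖ ≤ (‖f 0‖ + ε * t) * Real.exp (K * t) := by
  have h := norm_le_gronwallBound_of_norm_deriv_right_le
    (fun r _ => (hf r).continuousAt.continuousWithinAt) (fun r _ => (hf r).hasDerivWithinAt) le_rfl
    (fun r hr => hb r (Set.Ico_subset_Icc_self hr)) t (Set.right_mem_Icc.2 ht)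
  rw [sub_zero] at h
  exact h.trans (gronwallBound_le_mul_exp hK hε)

theorem norm_le_of_norm_deriv_le (hK : 0 ≤ K) (hε : 0 ≤ ε) (hf : ∀ r, HasDerivAt f (f' r) r)
    (hb : ∀ r, |r| ≤ |t| → ‖f' r‖ ≤ K * ‖f r‖ + ε) :
    ‖f t‖ ≤ (‖f 0‖ + ε * |t|) * Real.exp (K * |t|) := by
  rcases le_total 0 t with ht | ht
  · rw [abs_of_nonneg ht] at hb ⊢
    exact norm_le_of_norm_deriv_le_of_nonneg hK hε ht hf
      fun r hr => hb r ((abs_of_nonneg hr.1).le.trans hr.2)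
  · rw [abs_of_nonpos ht] at hb ⊢
    have hreversed := norm_le_of_norm_deriv_le_of_nonneg (f := fun r => f (-r))
      (f' := fun r => -f' (-r)) hK hε (neg_nonneg.2 ht)
      (fun r => by simpa [Function.comp_def] using (hf (-r)).scomp r (hasDerivAt_neg r))
      (fun r hr => by simpa using hb (-r) (by rw [abs_neg, abs_of_nonneg hr.1]; exact hr.2))
    simpa using hreversed

end Gronwall

/-! ### Flows of Lipschitz vector fields -/

section Flow

open scoped Manifold

variable {E : Type*} [NormedAddCommGroup E] [NormedSpace ℝ E] {v : E → E} {K : ℝ≥0}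

-- The existence time does not depend on the starting point: on the ball of radius `‖v x‖` around
-- `x` the field is bounded by `(1 + K) * ‖v x‖`.
theorem exists_hasDerivAt_Ioo_of_lipschitzWith [CompleteSpace E] (hv : LipschitzWith K v) (x : E) :
    ∃ α : ℝ → E, α 0 = x ∧
      ∀ t ∈ Set.Ioo (-(1 + K : ℝ)⁻¹) (1 + K : ℝ)⁻¹, HasDerivAt α (v (α t)) t := by
  have hτ : 0 ≤ (1 + K : ℝ)⁻¹ := by positivity
  have hbound : ∀ y ∈ Metric.closedBall x ‖v x‖₊, ‖v y‖ ≤ ((1 + K) * ‖v x‖₊ : ℝ≥0) := by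
    intro y hy
    have hlip : ‖v y - v x‖ ≤ K * ‖v x‖ :=
      (hv.norm_sub_le y x).trans (by gcongr; exact mem_closedBall_iff_norm.1 hy)
    push_cast
    linarith [norm_sub_norm_le (v y) (v x)]
  have hpl : IsPicardLindelof (fun _ => v) (tmin := -(1 + K : ℝ)⁻¹) (tmax := (1 + K : ℝ)⁻¹)
      ⟨0, by simp [hτ]⟩ x ‖v x‖₊ 0 ((1 + K) * ‖v x‖₊) K :=
    .of_time_independent hbound hv.lipschitzOnWith (by simp; field_simp; rfl)
  obtain ⟨α, hα₀, hα⟩ := hpl.exists_eq_forall_mem_Icc_hasDerivWithinAt₀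
  exact ⟨α, hα₀, fun t ht => (hα t (Set.Ioo_subset_Icc_self ht)).hasDerivAt
    (Icc_mem_nhds ht.1 ht.2)⟩

theorem exists_forall_hasDerivAt_of_lipschitzWith [CompleteSpace E] (hv : LipschitzWith K v)
    (hv₁ : ContDiff ℝ 1 v) (x : E) : ∃ α : ℝ → E, α 0 = x ∧ ∀ t, HasDerivAt α (v (α t)) t := by
  have hsection : ContMDiff 𝓘(ℝ, E) 𝓘(ℝ, E).tangent 1
      (fun y => (⟨y, v y⟩ : TangentBundle 𝓘(ℝ, E) E)) := fun y =>
    contMDiffAt_vectorSpace_iff_contDiffAt.2 hv₁.contDiffAt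
  obtain ⟨α, hα₀, hα⟩ := exists_isMIntegralCurve_of_isMIntegralCurveOn hsection
    (by positivity : 0 < (1 + K : ℝ)⁻¹)
    (fun y => by
      obtain ⟨α, hα₀, hα⟩ := exists_hasDerivAt_Ioo_of_lipschitzWith hv y
      exact ⟨α, hα₀, fun t ht => (hα t ht).hasFDerivAt.hasMFDerivAt.hasMFDerivWithinAt⟩) x
  exact ⟨α, hα₀, fun t => (hα t).hasFDerivAt⟩

end Flow

/-- `ψ x` is the integral curve of the autonomous vector field `v` that starts from `x`. -/
structure IsFlow {E : Type*} [NormedAddCommGroup E] [NormedSpace ℝ E] (v : E → E)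
    (ψ : E → ℝ → E) : Prop where
  zero : ∀ x, ψ x 0 = x
  hasDerivAt : ∀ x t, HasDerivAt (ψ x) (v (ψ x t)) t

theorem exists_isFlow {E : Type*} [NormedAddCommGroup E] [NormedSpace ℝ E] [CompleteSpace E]
    {v : E → E} {K : ℝ≥0} (hv : LipschitzWith K v) (hv₁ : ContDiff ℝ 1 v) : ∃ ψ, IsFlow v ψ := by
  choose ψ hψ₀ hψ using exists_forall_hasDerivAt_of_lipschitzWith hv hv₁
  exact ⟨ψ, hψ₀, hψ⟩

namespace IsFlow

variable {E : Type*} [NormedAddCommGroup E] [NormedSpace ℝ E] {v : E → E} {ψ : E → ℝ → E}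
  {K : ℝ≥0}

theorem flow_add (hψ : IsFlow v ψ) (hv : LipschitzWith K v) (x : E) (s t : ℝ) :
    ψ (ψ x s) t = ψ x (s + t) := by
  have heq : ψ (ψ x s) = fun t => ψ x (s + t) :=
    ODE_solution_unique_univ (v := fun _ => v) (s := fun _ => Set.univ) (t₀ := 0)
      (fun _ => hv.lipschitzOnWith) (fun t => ⟨hψ.hasDerivAt _ t, trivial⟩)
      (fun t => ⟨(hψ.hasDerivAt x (s + t)).comp_const_add s t, trivial⟩) (by simp [hψ.zero])
  exact congrFun heq t

theorem norm_sub_le (hψ : IsFlow v ψ) (hv : LipschitzWith K v) (x y : E) (s : ℝ) :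
    ‖ψ y s - ψ x s‖ ≤ ‖y - x‖ * Real.exp (K * |s|) := by
  have h := norm_le_of_norm_deriv_le (t := s) K.coe_nonneg le_rfl
    (fun r => (hψ.hasDerivAt y r).sub (hψ.hasDerivAt x r))
    (fun r _ => by simpa using hv.norm_sub_le (ψ y r) (ψ x r))
  simpa [hψ.zero] using h

theorem lipschitzWith (hψ : IsFlow v ψ) (hv : LipschitzWith K v) (s : ℝ) :
    LipschitzWith (Real.exp (K * |s|)).toNNReal fun x => ψ x s :=
  LipschitzWith.of_dist_le' fun x y => by
    simpa only [dist_eq_norm, mul_comm] using hψ.norm_sub_le hv y x s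

theorem norm_sub_self_le (hψ : IsFlow v ψ) (hv : LipschitzWith K v) (x : E) (s : ℝ) :
    ‖ψ x s - x‖ ≤ ‖v x‖ * |s| * Real.exp (K * |s|) := by
  have h := norm_le_of_norm_deriv_le (t := s) K.coe_nonneg (norm_nonneg (v x))
    (fun r => (hψ.hasDerivAt x r).sub_const x)
    (fun r _ => by linarith [hv.norm_sub_le (ψ x r) x, norm_sub_norm_le (v (ψ x r)) (v x)])
  simpa [hψ.zero] using h

theorem norm_sub_self_sub_smul_le (hψ : IsFlow v ψ) (hv : LipschitzWith K v) (x : E) (s : ℝ) :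
    ‖ψ x s - x - s • v x‖ ≤ K * ‖v x‖ * s ^ 2 * Real.exp (K * |s|) := by
  have hbound : ∀ r, |r| ≤ |s| →
      ‖v (ψ x r) - v x‖ ≤ K * ‖ψ x r - x - r • v x‖ + K * ‖v x‖ * |s| := fun r hr => by
    have hsplit : ‖ψ x r - x‖ ≤ ‖ψ x r - x - r • v x‖ + ‖v x‖ * |s| := by
      have hr' : ‖r • v x‖ ≤ ‖v x‖ * |s| := by
        rw [norm_smul, mul_comm]
        gcongr
        exact hr
      exact (norm_le_norm_sub_add _ _).trans (by gcongr)
    calc ‖v (ψ x r) - v x‖ ≤ K * ‖ψ x r - x‖ := hv.norm_sub_le _ _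
      _ ≤ K * (‖ψ x r - x - r • v x‖ + ‖v x‖ * |s|) := by gcongr
      _ = _ := by ring
  have h := norm_le_of_norm_deriv_le (f := fun r => ψ x r - x - r • v x) (t := s) K.coe_nonneg
    (by positivity)
    (fun r => by
      simpa using ((hψ.hasDerivAt x r).sub_const x).fun_sub ((hasDerivAt_id r).smul_const (v x)))
    hbound
  have hsq : K * ‖v x‖ * |s| * |s| = K * ‖v x‖ * s ^ 2 := by rw [mul_assoc, abs_mul_abs_self, sq]
  simpa [hψ.zero, hsq] using h

end IsFlow

/-! ### Functions with a quadratic Taylor remainder -/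

/-- Functions on the line of class `C^{1,1}`, with derivative `f'`. The differentiability and the
Lipschitz continuity of `f'` are both encoded in the quadratic Taylor remainder, which is stable
under composition and integration with respect to a parameter. -/
structure IsCOneOne (K : ℝ≥0) (f f' : ℝ → ℝ) : Prop where
  abs_deriv_le : ∀ x, |f' x| ≤ K
  taylor : ∀ x y, |f y - f x - f' x * (y - x)| ≤ K * (y - x) ^ 2

namespace IsCOneOne

variable {K L : ℝ≥0} {f f' h h' : ℝ → ℝ}

theorem hasDerivAt (hf : IsCOneOne K f f') (x : ℝ) : HasDerivAt f (f' x) x := by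
  have hO : (fun y => f y - f x - (y - x) • f' x) =O[𝓝 x] fun y => ‖y - x‖ ^ 2 :=
    .of_bound K (Eventually.of_forall fun y => by
      simpa [mul_comm] using hf.taylor x y)
  exact hasDerivAt_iff_isLittleO.2 (hO.trans_isLittleO
    (Asymptotics.isLittleO_pow_sub_sub x one_lt_two))

theorem lipschitzWith (hf : IsCOneOne K f f') : LipschitzWith K f :=
  lipschitzWith_of_nnnorm_deriv_le (fun x => (hf.hasDerivAt x).differentiableAt) fun x => by
    rw [(hf.hasDerivAt x).deriv]
    exact hf.abs_deriv_le x

theorem lipschitzWith_deriv (hf : IsCOneOne K f f') : LipschitzWith (2 * K) f' :=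
  LipschitzWith.of_dist_le_mul fun x y => by
    rcases eq_or_ne x y with rfl | hxy
    · simp
    have hpos : 0 < |y - x| := abs_pos.2 (sub_ne_zero.2 hxy.symm)
    refine le_of_mul_le_mul_right ?_ hpos
    calc dist (f' x) (f' y) * |y - x| = |(f' x - f' y) * (y - x)| := (abs_mul _ _).symm
      _ = |(f x - f y - f' y * (x - y)) + (f y - f x - f' x * (y - x))| := by
        rw [← abs_neg]; ring_nf
      _ ≤ K * (x - y) ^ 2 + K * (y - x) ^ 2 :=
        (abs_add_le _ _).trans (add_le_add (hf.taylor y x) (hf.taylor x y))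
      _ = (2 * K : ℝ≥0) * dist x y * |y - x| := by
        rw [Real.dist_eq, abs_sub_comm x y, mul_assoc, abs_mul_abs_self]
        push_cast
        ring

theorem contDiff (hf : IsCOneOne K f f') : ContDiff ℝ 1 f := by
  have hderiv : deriv f = f' := funext fun x => (hf.hasDerivAt x).deriv
  refine contDiff_one_iff_deriv.2 ⟨fun x => (hf.hasDerivAt x).differentiableAt, ?_⟩
  rw [hderiv]
  exact hf.lipschitzWith_deriv.continuous

theorem of_hasDerivAt (hd : ∀ x, HasDerivAt f (f' x) x) (hb : ∀ x, |f' x| ≤ K)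
    (hl : LipschitzWith K f') : IsCOneOne K f f' where
  abs_deriv_le := hb
  taylor x y := by
    have hder : ∀ z, HasDerivAt (fun z => f z - f' x * z) (f' z - f' x) z := fun z => by
      simpa using (hd z).fun_sub ((hasDerivAt_id z).const_mul (f' x))
    have hmean := (convex_uIcc x y).norm_image_sub_le_of_norm_hasDerivWithin_le
      (C := K * |y - x|) (fun z _ => (hder z).hasDerivWithinAt)
      (fun z hz => (hl.norm_sub_le z x).trans (by gcongr; exact Set.abs_sub_left_of_mem_uIcc hz))
      Set.left_mem_uIcc Set.right_mem_uIcc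
    calc |f y - f x - f' x * (y - x)| = ‖f y - f' x * y - (f x - f' x * x)‖ := by
          rw [Real.norm_eq_abs]; ring_nf
      _ ≤ K * |y - x| * ‖y - x‖ := hmean
      _ = K * (y - x) ^ 2 := by rw [Real.norm_eq_abs, mul_assoc, abs_mul_abs_self, sq]

theorem comp (hh : IsCOneOne L h h') (hf : IsCOneOne K f f') :
    IsCOneOne (L * K * (K + 1)) (fun x => h (f x)) (fun x => h' (f x) * f' x) where
  abs_deriv_le x := by
    calc |h' (f x) * f' x| ≤ L * K := by
          rw [abs_mul]
          exact mul_le_mul (hh.abs_deriv_le _) (hf.abs_deriv_le _) (abs_nonneg _) L.coe_nonneg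
      _ ≤ (L * K * (K + 1) : ℝ≥0) := by
          exact_mod_cast le_mul_of_one_le_right (zero_le (a := L * K)) le_add_self
  taylor x y := by
    have houter : |h (f y) - h (f x) - h' (f x) * (f y - f x)| ≤ L * K ^ 2 * (y - x) ^ 2 :=
      calc |h (f y) - h (f x) - h' (f x) * (f y - f x)| ≤ L * (f y - f x) ^ 2 := hh.taylor _ _
        _ ≤ L * (K * |y - x|) ^ 2 := by
          rw [← sq_abs (f y - f x)]
          gcongr
          exact hf.lipschitzWith.norm_sub_le y x
        _ = L * K ^ 2 * (y - x) ^ 2 := by rw [mul_pow, sq_abs]; ring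
    have hinner : |h' (f x) * (f y - f x - f' x * (y - x))| ≤ L * (K * (y - x) ^ 2) := by
      rw [abs_mul]
      exact mul_le_mul (hh.abs_deriv_le _) (hf.taylor x y) (abs_nonneg _) L.coe_nonneg
    calc |h (f y) - h (f x) - h' (f x) * f' x * (y - x)|
        = |(h (f y) - h (f x) - h' (f x) * (f y - f x)) +
            h' (f x) * (f y - f x - f' x * (y - x))| := by ring_nf
      _ ≤ L * K ^ 2 * (y - x) ^ 2 + L * (K * (y - x) ^ 2) :=
        (abs_add_le _ _).trans (add_le_add houter hinner)
      _ = (L * K * (K + 1) : ℝ≥0) * (y - x) ^ 2 := by push_cast; ring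

theorem integral {M : Type*} [MeasurableSpace M] {ν : Measure M} [IsProbabilityMeasure ν]
    {F F' : ℝ → M → ℝ} (hF : ∀ m, IsCOneOne K (fun x => F x m) (fun x => F' x m))
    (hi : ∀ x, Integrable (F x) ν) (hm : ∀ x, AEStronglyMeasurable (F' x) ν) :
    IsCOneOne K (fun x => ∫ m, F x m ∂ν) (fun x => ∫ m, F' x m ∂ν) := by
  have hbound : ∀ {u : M → ℝ} {c : ℝ}, (∀ m, |u m| ≤ c) → |∫ m, u m ∂ν| ≤ c := fun {u c} hu => by
    simpa using norm_integral_le_of_norm_le_const (f := u) (ae_of_all ν hu)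
  have hi' : ∀ x, Integrable (F' x) ν := fun x =>
    .of_bound (hm x) K (ae_of_all _ fun m => (hF m).abs_deriv_le x)
  refine ⟨fun x => hbound fun m => (hF m).abs_deriv_le x, fun x y => ?_⟩
  rw [← integral_sub (hi y) (hi x), ← integral_mul_const,
    ← integral_sub ((hi y).sub' (hi x)) ((hi' x).mul_const _)]
  exact hbound fun m => (hF m).taylor x y

end IsCOneOne

/-! ### Regularity of the flow in its starting point -/

theorem IsFlow.abs_taylor_le {K : ℝ≥0} {v v' : ℝ → ℝ} {ψ : ℝ → ℝ → ℝ} (hψ : IsFlow v ψ)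
    (hv : IsCOneOne K v v') (x y s : ℝ) :
    |ψ y s - ψ x s - Real.exp (∫ u in (0 : ℝ)..s, v' (ψ x u)) * (y - x)| ≤
      K * |s| * Real.exp (3 * (K * |s|)) * (y - x) ^ 2 := by
  have hcont : Continuous fun r => v' (ψ x r) := hv.lipschitzWith_deriv.continuous.comp
    (continuous_iff_continuousAt.2 fun r => (hψ.hasDerivAt x r).continuousAt)
  set D : ℝ → ℝ := fun r => Real.exp (∫ u in (0 : ℝ)..r, v' (ψ x u)) with hD
  have hlinearized : ∀ r, HasDerivAt D (v' (ψ x r) * D r) r := fun r => by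
    simpa only [mul_comm] using (hcont.integral_hasStrictDerivAt 0 r).hasDerivAt.exp
  have hbound : ∀ r, |r| ≤ |s| → |v (ψ y r) - v (ψ x r) - v' (ψ x r) * D r * (y - x)| ≤
      K * |ψ y r - ψ x r - D r * (y - x)| + K * (|y - x| * Real.exp (K * |s|)) ^ 2 := by
    intro r hr
    have hdist : |ψ y r - ψ x r| ≤ |y - x| * Real.exp (K * |s|) :=
      (hψ.norm_sub_le hv.lipschitzWith x y r).trans (by rw [Real.norm_eq_abs]; gcongr)
    have hquad : |v (ψ y r) - v (ψ x r) - v' (ψ x r) * (ψ y r - ψ x r)| ≤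
        K * (|y - x| * Real.exp (K * |s|)) ^ 2 :=
      (hv.taylor _ _).trans (by rw [← sq_abs (ψ y r - ψ x r)]; gcongr)
    have hlin : |v' (ψ x r) * (ψ y r - ψ x r - D r * (y - x))| ≤
        K * |ψ y r - ψ x r - D r * (y - x)| := by
      rw [abs_mul]
      gcongr
      exact hv.abs_deriv_le _
    calc |v (ψ y r) - v (ψ x r) - v' (ψ x r) * D r * (y - x)|
        = |v' (ψ x r) * (ψ y r - ψ x r - D r * (y - x)) +
            (v (ψ y r) - v (ψ x r) - v' (ψ x r) * (ψ y r - ψ x r))| := by ring_nf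
      _ ≤ _ := (abs_add_le _ _).trans (add_le_add hlin hquad)
  have hgronwall := norm_le_of_norm_deriv_le (t := s)
    (f := fun r => ψ y r - ψ x r - D r * (y - x)) K.coe_nonneg (by positivity)
    (fun r => ((hψ.hasDerivAt y r).sub (hψ.hasDerivAt x r)).sub
      ((hlinearized r).mul_const (y - x))) hbound
  have hcube : Real.exp (3 * (K * |s|)) = Real.exp (K * |s|) ^ 3 := by
    rw [← Real.exp_nat_mul, Nat.cast_ofNat]
  refine hgronwall.trans_eq ?_
  simp only [hψ.zero, hD, intervalIntegral.integral_same, Real.exp_zero, one_mul, sub_self,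
    norm_zero, zero_add, mul_pow, sq_abs, hcube]
  ring

theorem IsFlow.exists_isCOneOne {K : ℝ≥0} {v v' : ℝ → ℝ} {ψ : ℝ → ℝ → ℝ} (hψ : IsFlow v ψ)
    (hv : IsCOneOne K v v') (S : ℝ≥0) : ∃ C, ∀ s : ℝ, |s| ≤ S →
      IsCOneOne C (fun x => ψ x s) (fun x => Real.exp (∫ u in (0 : ℝ)..s, v' (ψ x u))) := by
  refine ⟨((1 + K * S) * Real.exp (3 * (K * S))).toNNReal, fun s hs => ⟨fun x => ?_, fun x y => ?_⟩⟩
  all_goals rw [Real.coe_toNNReal _ (by positivity)]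
  · have hint : ∫ u in (0 : ℝ)..s, v' (ψ x u) ≤ K * |s| := by
      have hnorm := intervalIntegral.norm_integral_le_of_norm_le_const (a := 0) (b := s)
        (f := fun u => v' (ψ x u)) fun u _ => hv.abs_deriv_le (ψ x u)
      rw [sub_zero] at hnorm
      exact (le_abs_self _).trans hnorm
    calc |Real.exp (∫ u in (0 : ℝ)..s, v' (ψ x u))| ≤ Real.exp (K * S) := by
          rw [Real.abs_exp]
          gcongr
          exact hint.trans (by gcongr)
      _ ≤ Real.exp (3 * (K * S)) :=
        Real.exp_le_exp.2 (by linarith [mul_nonneg K.coe_nonneg S.coe_nonneg])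
      _ ≤ (1 + K * S) * Real.exp (3 * (K * S)) :=
        le_mul_of_one_le_left (Real.exp_pos _).le
          (le_add_of_nonneg_right (mul_nonneg K.coe_nonneg S.coe_nonneg))
  · calc |ψ y s - ψ x s - Real.exp (∫ u in (0 : ℝ)..s, v' (ψ x u)) * (y - x)|
        ≤ K * |s| * Real.exp (3 * (K * |s|)) * (y - x) ^ 2 := hψ.abs_taylor_le hv x y s
      _ ≤ (1 + K * S) * Real.exp (3 * (K * S)) * (y - x) ^ 2 := by
        gcongr
        exact (mul_le_mul_of_nonneg_left hs K.coe_nonneg).trans (le_add_of_nonneg_left zero_le_one)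

theorem IsCOneOne.exists_comp_flow {K L : ℝ≥0} {h h' v v' : ℝ → ℝ} {ψ : ℝ → ℝ → ℝ}
    (hh : IsCOneOne L h h') (hψ : IsFlow v ψ) (hv : IsCOneOne K v v') (S : ℝ≥0) :
    ∃ C, ∀ s : ℝ, |s| ≤ S → ∃ d, IsCOneOne C (fun x => h (ψ x s)) d := by
  obtain ⟨C, hC⟩ := hψ.exists_isCOneOne hv S
  exact ⟨L * C * (C + 1), fun s hs => ⟨_, hh.comp (hC s hs)⟩⟩

/-! ### The Japanese bracket -/

/-- The Japanese bracket `⟨x⟩`, a smooth substitute for the weight `1 + |x|`. -/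
def bracket (x : ℝ) : ℝ := √(1 + x ^ 2)

theorem sq_bracket (x : ℝ) : bracket x ^ 2 = 1 + x ^ 2 :=
  Real.sq_sqrt (by positivity)

theorem one_le_bracket (x : ℝ) : 1 ≤ bracket x :=
  Real.one_le_sqrt.2 (le_add_of_nonneg_right (sq_nonneg x))

theorem bracket_pos (x : ℝ) : 0 < bracket x :=
  zero_lt_one.trans_le (one_le_bracket x)

theorem abs_le_bracket (x : ℝ) : |x| ≤ bracket x :=
  Real.abs_le_sqrt (le_add_of_nonneg_left zero_le_one)

theorem isCOneOne_bracket : IsCOneOne 1 bracket (fun x => x / bracket x) where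
  abs_deriv_le x := by
    rw [abs_div, abs_of_pos (bracket_pos x), NNReal.coe_one]
    exact div_le_one_of_le₀ (abs_le_bracket x) (bracket_pos x).le
  taylor x y := by
    have hremainder : bracket y - bracket x - x / bracket x * (y - x) =
        (bracket x * bracket y - (1 + x * y)) / bracket x := by
      have := (bracket_pos x).ne'
      field_simp
      linear_combination -sq_bracket x
    have hcauchy : 1 + x * y ≤ bracket x * bracket y := by
      refine (le_abs_self _).trans (abs_le_of_sq_le_sq ?_ ?_)
      · rw [mul_pow, sq_bracket, sq_bracket]
        linarith [sq_nonneg (x - y)]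
      · exact mul_nonneg (bracket_pos x).le (bracket_pos y).le
    have hyoung : bracket x * bracket y - (1 + x * y) ≤ (y - x) ^ 2 := by
      linarith [sq_nonneg (bracket x - bracket y), sq_bracket x, sq_bracket y, sq_nonneg (y - x)]
    rw [hremainder, abs_of_nonneg (div_nonneg (sub_nonneg.2 hcauchy) (bracket_pos x).le),
      NNReal.coe_one, one_mul]
    exact (div_le_self (sub_nonneg.2 hcauchy) (one_le_bracket x)).trans hyoung

theorem norm_le_mul_bracket_of_lipschitzWith {F : Type*} [SeminormedAddCommGroup F] {K : ℝ≥0}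
    {v : ℝ → F} (hv : LipschitzWith K v) (x : ℝ) : ‖v x‖ ≤ (‖v 0‖ + K) * bracket x :=
  calc ‖v x‖ ≤ ‖v 0‖ + K * |x| := by
        have hlip := hv.norm_sub_le x 0
        rw [sub_zero, Real.norm_eq_abs] at hlip
        linarith [norm_sub_norm_le (v x) (v 0)]
    _ ≤ ‖v 0‖ * bracket x + K * bracket x := by
        gcongr
        · exact le_mul_of_one_le_right (norm_nonneg _) (one_le_bracket x)
        · exact abs_le_bracket x
    _ = (‖v 0‖ + K) * bracket x := by ring

theorem IsFlow.exists_bracket_le {K : ℝ≥0} {v : ℝ → ℝ} {ψ : ℝ → ℝ → ℝ} (hψ : IsFlow v ψ)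
    (hv : LipschitzWith K v) (S : ℝ≥0) :
    ∃ C : ℝ≥0, ∀ s : ℝ, |s| ≤ S → ∀ x, bracket x ≤ C * bracket (ψ x s) := by
  refine ⟨1 + (‖v 0‖₊ + K) * S * (Real.exp (K * S)).toNNReal, fun s hs x => ?_⟩
  set y := ψ x s with hy
  have hback : |x - y| ≤ ‖v y‖ * |s| * Real.exp (K * |s|) := by
    simpa [hy, hψ.flow_add hv, hψ.zero] using hψ.norm_sub_self_le hv y (-s)
  have hlip : bracket x - bracket y ≤ |x - y| := by
    simpa using (le_abs_self _).trans (isCOneOne_bracket.lipschitzWith.norm_sub_le x y)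
  calc bracket x ≤ bracket y + ‖v y‖ * |s| * Real.exp (K * |s|) := by linarith
    _ ≤ bracket y + (‖v 0‖ + K) * bracket y * S * Real.exp (K * S) := by
      have := bracket_pos y
      gcongr
      exact norm_le_mul_bracket_of_lipschitzWith hv y
    _ = _ := by
      push_cast
      rw [Real.coe_toNNReal _ (Real.exp_pos _).le]
      ring

/-! ### Regularity of the coefficients -/

/-- Functions of class `C^n` with bounded derivatives of order `1, …, n`; the function itself need
not be bounded. -/
def HasBoundedDerivs {E : Type*} [NormedAddCommGroup E] [NormedSpace ℝ E] (n : ℕ) (g : E → ℝ) :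
    Prop :=
  ContDiff ℝ n g ∧ ∀ k : ℕ, 1 ≤ k → k ≤ n → ∃ C : ℝ, ∀ z, ‖iteratedFDeriv ℝ k g z‖ ≤ C

namespace HasBoundedDerivs

variable {E : Type*} [NormedAddCommGroup E] [NormedSpace ℝ E] {g : E → ℝ}

theorem mono {k n : ℕ} (hg : HasBoundedDerivs n g) (hkn : k ≤ n) : HasBoundedDerivs k g :=
  ⟨hg.1.of_le (by exact_mod_cast hkn), fun i hi hik => hg.2 i hi (hik.trans hkn)⟩

theorem exists_lipschitzWith (hg : HasBoundedDerivs 2 g) :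
    ∃ K, LipschitzWith K g ∧ LipschitzWith K (fderiv ℝ g) ∧ ∀ z, ‖fderiv ℝ g z‖₊ ≤ K := by
  obtain ⟨C₁, hC₁⟩ := hg.2 1 le_rfl one_le_two
  obtain ⟨C₂, hC₂⟩ := hg.2 2 one_le_two le_rfl
  have hdiff : Differentiable ℝ g := hg.1.differentiable two_ne_zero
  have hdiff' : Differentiable ℝ (fderiv ℝ g) :=
    (hg.1.fderiv_right (m := 1) (by norm_num)).differentiable one_ne_zero
  have hfirst : ∀ z, ‖fderiv ℝ g z‖₊ ≤ max C₁.toNNReal C₂.toNNReal := fun z =>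
    le_max_of_le_left <| NNReal.le_toNNReal_of_coe_le <| by simpa using hC₁ z
  have hsecond : ∀ z, ‖fderiv ℝ (fderiv ℝ g) z‖₊ ≤ max C₁.toNNReal C₂.toNNReal := fun z =>
    le_max_of_le_right <| NNReal.le_toNNReal_of_coe_le <| by
      simpa [← norm_iteratedFDeriv_fderiv (n := 1)] using hC₂ z
  exact ⟨max C₁.toNNReal C₂.toNNReal, lipschitzWith_of_nnnorm_fderiv_le hdiff hfirst,
    lipschitzWith_of_nnnorm_fderiv_le hdiff' hsecond, hfirst⟩

theorem exists_isCOneOne_comp_line (hg : HasBoundedDerivs 2 g) : ∃ K, ∀ a e : E, ‖e‖ ≤ 1 →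
    IsCOneOne K (fun x : ℝ => g (a + x • e)) (fun x => fderiv ℝ g (a + x • e) e) := by
  obtain ⟨K, -, hK', hbound⟩ := hg.exists_lipschitzWith
  refine ⟨K, fun a e he => .of_hasDerivAt (fun x => ?_) (fun x => ?_)
    (.of_dist_le_mul fun x y => ?_)⟩
  · have hline : HasDerivAt (fun x : ℝ => a + x • e) e x := by
      simpa using ((hasDerivAt_id x).smul_const e).const_add a
    exact ((hg.1.differentiable two_ne_zero _).hasFDerivAt).comp_hasDerivAt x hline
  · exact ((fderiv ℝ g _).unit_le_opNorm e he).trans (hbound _)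
  · calc dist (fderiv ℝ g (a + x • e) e) (fderiv ℝ g (a + y • e) e)
        ≤ dist (fderiv ℝ g (a + x • e)) (fderiv ℝ g (a + y • e)) := by
          rw [dist_eq_norm, dist_eq_norm, ← sub_apply]
          exact ContinuousLinearMap.unit_le_opNorm _ e he
      _ ≤ K * dist (a + x • e) (a + y • e) := hK'.dist_le_mul _ _
      _ ≤ K * dist x y := by
        gcongr
        rw [dist_add_left, dist_eq_norm, ← sub_smul, norm_smul, ← dist_eq_norm]
        exact mul_le_of_le_one_right dist_nonneg he

theorem exists_isCOneOne_integral {M : Type*} [NormedAddCommGroup M] [NormedSpace ℝ M]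
    [MeasurableSpace M] [BorelSpace M] [SecondCountableTopology M] {ν : Measure M}
    [IsProbabilityMeasure ν] {g : ℝ × M → ℝ} (hg : HasBoundedDerivs 2 g)
    (hi : ∀ x, Integrable (fun m => g (x, m)) ν) :
    ∃ K v', IsCOneOne K (fun x => ∫ m, g (x, m) ∂ν) v' := by
  obtain ⟨K, hline⟩ := hg.exists_isCOneOne_comp_line
  have hcont : Continuous fun z => fderiv ℝ g z (1, 0) :=
    (hg.1.continuous_fderiv two_ne_zero).clm_apply continuous_const
  refine ⟨K, fun x => ∫ m, fderiv ℝ g (x, m) (1, 0) ∂ν,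
    .integral (fun m => ?_) hi fun x => (hcont.comp (.prodMk_right x)).aestronglyMeasurable⟩
  simpa using hline (0, m) (1, 0) (by simp)

end HasBoundedDerivs

theorem IsCb.mono {k n : ℕ} {φ : ℝ → ℝ} (hφ : IsCb n φ) (hkn : k ≤ n) : IsCb k φ :=
  ⟨hφ.1.of_le (by exact_mod_cast hkn), fun i hi => hφ.2 i (hi.trans hkn)⟩

theorem IsCb.exists_isCOneOne {φ : ℝ → ℝ} (hφ : IsCb 2 φ) : ∃ L φ', IsCOneOne L φ φ' := by
  have hbounded : HasBoundedDerivs 2 φ := ⟨hφ.1, fun k _ hk => by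
    simpa only [norm_iteratedFDeriv_eq_norm_iteratedDeriv, Real.norm_eq_abs] using hφ.2 k hk⟩
  obtain ⟨L, hL⟩ := hbounded.exists_isCOneOne_comp_line
  exact ⟨L, _, by simpa using hL 0 1 norm_one.le⟩

/-! ### One step of the scheme -/

theorem integrable_comp_of_lipschitzWith {Ω E F : Type*} [MeasurableSpace Ω]
    [NormedAddCommGroup E] [NormedAddCommGroup F] {μ : Measure Ω} [IsFiniteMeasure μ] {L : ℝ≥0}
    {f : E → F} (hf : LipschitzWith L f) {X : Ω → E} (hX : Integrable X μ) :
    Integrable (fun ω => f (X ω)) μ := by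
  have hsub : LipschitzWith L fun x => f x - f 0 := by
    simpa using hf.sub (LipschitzWith.const (f 0))
  have hmem := hsub.comp_memLp (sub_self _) (memLp_one_iff_integrable.2 hX)
  simpa [Function.comp_def] using
    (memLp_one_iff_integrable.1 hmem).fun_add (integrable_const (f 0))

theorem IsCOneOne.abs_integral_add_sub_le {M : Type*} [MeasurableSpace M] {ν : Measure M}
    [IsProbabilityMeasure ν] {L : ℝ≥0} {f f' : ℝ → ℝ} (hf : IsCOneOne L f f') {ξ : M → ℝ}
    (hξ : MemLp ξ 2 ν) (hzero : ∫ m, ξ m ∂ν = 0) (z : ℝ) :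
    |∫ m, f (z + ξ m) ∂ν - f z| ≤ L * ∫ m, ξ m ^ 2 ∂ν := by
  have hξ₁ : Integrable ξ ν := hξ.integrable one_le_two
  have hi : Integrable (fun m => f (z + ξ m)) ν :=
    integrable_comp_of_lipschitzWith hf.lipschitzWith ((integrable_const z).add hξ₁)
  have hsplit : ∫ m, f (z + ξ m) ∂ν - f z = ∫ m, (f (z + ξ m) - f z - f' z * ξ m) ∂ν := by
    rw [integral_sub (hi.sub' (integrable_const _)) (hξ₁.const_mul _),
      integral_sub hi (integrable_const _), integral_const_mul, hzero]
    simp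
  rw [hsplit, ← integral_const_mul, ← Real.norm_eq_abs]
  refine norm_integral_le_of_norm_le (hξ.integrable_sq.const_mul _) (ae_of_all _ fun m => ?_)
  simpa using hf.taylor z (z + ξ m)

theorem abs_integral_comp_sub_le_of_indepFun {Ω E M : Type*} [MeasurableSpace Ω]
    [MeasurableSpace E] [MeasurableSpace M] {P : Measure Ω} [IsProbabilityMeasure P]
    {ν : Measure M} [SFinite ν] {X : Ω → E} {γ : Ω → M} (hX : Measurable X) (hγ : HasLaw γ ν P)
    (hindep : IndepFun X γ P) {F : E × M → ℝ} {u w : E → ℝ} (hFm : Measurable F)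
    (hF : Integrable (fun ω => F (X ω, γ ω)) P) (hu : Integrable (fun ω => u (X ω)) P)
    (hw : Integrable (fun ω => w (X ω)) P) (hle : ∀ x, |∫ m, F (x, m) ∂ν - u x| ≤ w x) :
    |∫ ω, F (X ω, γ ω) ∂P - ∫ ω, u (X ω) ∂P| ≤ ∫ ω, w (X ω) ∂P := by
  have hlaw : HasLaw (fun ω => (X ω, γ ω)) ((P.map X).prod ν) P :=
    IndepFun.hasLaw_prod ⟨hX.aemeasurable, rfl⟩ hγ hindep
  have hFprod : Integrable F ((P.map X).prod ν) := by
    rw [← hlaw.map_eq]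
    exact (integrable_map_measure hFm.aestronglyMeasurable hlaw.aemeasurable).2 hF
  have : IsProbabilityMeasure (P.map X) := Measure.isProbabilityMeasure_map hX.aemeasurable
  have hinner : Integrable (fun ω => ∫ m, F (X ω, m) ∂ν) P :=
    hFprod.integral_prod_left.comp_measurable hX
  have hfubini : ∫ ω, F (X ω, γ ω) ∂P = ∫ ω, ∫ m, F (X ω, m) ∂ν ∂P := by
    calc ∫ ω, F (X ω, γ ω) ∂P = ∫ p, F p ∂((P.map X).prod ν) :=
          hlaw.integral_comp hFm.aestronglyMeasurable
      _ = ∫ x, ∫ m, F (x, m) ∂ν ∂(P.map X) := integral_prod F hFprod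
      _ = ∫ ω, ∫ m, F (X ω, m) ∂ν ∂P :=
          integral_map hX.aemeasurable hFprod.integral_prod_left.aestronglyMeasurable
  rw [hfubini, ← integral_sub hinner hu, ← Real.norm_eq_abs]
  exact norm_integral_le_of_norm_le hw (ae_of_all _ fun ω => hle (X ω))

/-- `G` is a coefficient depending on a noise of law `ν`, with average `v`; the fluctuation
`G (x, ·) - v x` has the square integrable envelope `a`, which does not depend on `x`. -/
structure IsNoisyCoeff {M : Type*} [MeasurableSpace M] (ν : Measure M) (G : ℝ × M → ℝ)
    (v : ℝ → ℝ) (a : M → ℝ) : Prop where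
  measurable : Measurable G
  memLp : MemLp a 2 ν
  abs_fluctuation_le : ∀ x m, |G (x, m) - v x| ≤ a m
  integral_eq : ∀ x, ∫ m, G (x, m) ∂ν = v x

theorem isNoisyCoeff_comp_fst {M : Type*} [MeasurableSpace M] {ν : Measure M}
    [IsProbabilityMeasure ν] {v : ℝ → ℝ} (hv : Measurable v) :
    IsNoisyCoeff ν (fun z => v z.1) v 0 where
  measurable := hv.comp measurable_fst
  memLp := MemLp.zero
  abs_fluctuation_le x m := by simp
  integral_eq x := by simp

theorem isNoisyCoeff_of_lipschitzWith {M : Type*} [NormedAddCommGroup M] [MeasurableSpace M]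
    [BorelSpace M] [SecondCountableTopology M] {ν : Measure M} [IsProbabilityMeasure ν]
    (hν : MemLp id 2 ν) {K : ℝ≥0} {g : ℝ × M → ℝ} (hg : LipschitzWith K g) :
    IsNoisyCoeff ν g (fun x => ∫ m, g (x, m) ∂ν) (fun m => K * (‖m‖ + ∫ m', ‖m'‖ ∂ν)) where
  measurable := hg.continuous.measurable
  memLp := (hν.norm.add (memLp_const _)).const_mul _
  abs_fluctuation_le x m := by
    have hi : Integrable (fun m' => g (x, m')) ν :=
      integrable_comp_of_lipschitzWith (hg.comp (LipschitzWith.prodMk_left x))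
        (hν.integrable one_le_two)
    have hnorm : Integrable (fun m' : M => ‖m'‖) ν := (hν.integrable one_le_two).norm
    calc |g (x, m) - ∫ m', g (x, m') ∂ν| = ‖∫ m', (g (x, m) - g (x, m')) ∂ν‖ := by
          rw [integral_sub (integrable_const _) hi]
          simp
      _ ≤ ∫ m', K * (‖m‖ + ‖m'‖) ∂ν := by
        refine norm_integral_le_of_norm_le (((integrable_const _).add hnorm).const_mul _)
          (ae_of_all _ fun m' => (hg.norm_sub_le _ _).trans ?_)
        gcongr
        simpa using norm_sub_le m m'
      _ = K * (‖m‖ + ∫ m', ‖m'‖ ∂ν) := by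
        rw [integral_const_mul, integral_add (integrable_const _) hnorm]
        simp
  integral_eq _ := rfl

namespace IsNoisyCoeff

variable {M : Type*} [MeasurableSpace M] {ν : Measure M}
  {G : ℝ × M → ℝ} {v : ℝ → ℝ} {a : M → ℝ} {K L : ℝ≥0} {f f' : ℝ → ℝ} {ψ : ℝ → ℝ → ℝ}

theorem memLp_sub (hG : IsNoisyCoeff ν G v a) (x : ℝ) : MemLp (fun m => G (x, m) - v x) 2 ν :=
  hG.memLp.mono' ((hG.measurable.comp measurable_prodMk_left).sub_const _).aestronglyMeasurable
    (ae_of_all _ (hG.abs_fluctuation_le x))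

theorem integrable_comp {Ω : Type*} [MeasurableSpace Ω] {P : Measure Ω} [IsFiniteMeasure P]
    (hG : IsNoisyCoeff ν G v a) (hv : LipschitzWith K v) {X : Ω → ℝ} {γ : Ω → M}
    (hX : Measurable X) (hXi : Integrable X P) (hγ : Measurable γ) (hlaw : HasLaw γ ν P) :
    Integrable (fun ω => G (X ω, γ ω)) P := by
  have henvelope : Integrable (fun ω => a (γ ω)) P := by
    have hmem := hG.memLp
    rw [← hlaw.map_eq] at hmem
    exact (hmem.comp_of_map hlaw.aemeasurable).integrable one_le_two
  have hfluct : Integrable (fun ω => G (X ω, γ ω) - v (X ω)) P :=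
    henvelope.mono' ((hG.measurable.comp (hX.prodMk hγ)).sub
      (hv.continuous.measurable.comp hX)).aestronglyMeasurable
      (ae_of_all _ fun ω => hG.abs_fluctuation_le _ _)
  simpa using hfluct.fun_add (integrable_comp_of_lipschitzWith hv hXi)

variable [IsProbabilityMeasure ν]

theorem integrable (hG : IsNoisyCoeff ν G v a) (x : ℝ) : Integrable (fun m => G (x, m)) ν := by
  simpa using ((hG.memLp_sub x).integrable one_le_two).fun_add (integrable_const (v x))

theorem integral_sub_eq_zero (hG : IsNoisyCoeff ν G v a) (x : ℝ) :
    ∫ m, (G (x, m) - v x) ∂ν = 0 := by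
  rw [integral_sub (hG.integrable x) (integrable_const _), hG.integral_eq]
  simp

theorem abs_integral_comp_sub_flow_le (hG : IsNoisyCoeff ν G v a) (hv : LipschitzWith K v)
    (hψ : IsFlow v ψ) (hf : IsCOneOne L f f') (x b : ℝ) :
    |∫ m, f (x + G (x, m) * b) ∂ν - f (ψ x b)| ≤
      L * (K * |v x| * Real.exp (K * |b|) + ∫ m, a m ^ 2 ∂ν) * b ^ 2 := by
  have hnoise : |∫ m, f (x + b * v x + (G (x, m) - v x) * b) ∂ν - f (x + b * v x)| ≤
      L * ((∫ m, a m ^ 2 ∂ν) * b ^ 2) := by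
    refine (hf.abs_integral_add_sub_le ((hG.memLp_sub x).mul_const b) ?_ _).trans ?_
    · rw [integral_mul_const, hG.integral_sub_eq_zero, zero_mul]
    · simp only [mul_pow, integral_mul_const]
      gcongr ?_ * (?_ * ?_)
      exact integral_mono (hG.memLp_sub x).integrable_sq hG.memLp.integrable_sq fun m =>
        sq_le_sq.2 ((hG.abs_fluctuation_le x m).trans (le_abs_self _))
  have hdrift : |f (x + b * v x) - f (ψ x b)| ≤ L * (K * |v x| * b ^ 2 * Real.exp (K * |b|)) := by
    refine (hf.lipschitzWith.norm_sub_le _ _).trans ?_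
    gcongr
    rw [norm_sub_rev, ← sub_sub]
    exact hψ.norm_sub_self_sub_smul_le hv x b
  have hrw : ∀ m, x + G (x, m) * b = x + b * v x + (G (x, m) - v x) * b := fun m => by ring
  simp only [hrw]
  refine ((abs_sub_le _ (f (x + b * v x)) _).trans (add_le_add hnoise hdrift)).trans_eq ?_
  ring

theorem exists_abs_integral_comp_sub_flow_le (hG : IsNoisyCoeff ν G v a) (hv : LipschitzWith K v)
    (hψ : IsFlow v ψ) (L S : ℝ≥0) : ∃ C : ℝ≥0, ∀ f f', IsCOneOne L f f' → ∀ x b : ℝ, |b| ≤ S →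
      |∫ m, f (x + G (x, m) * b) ∂ν - f (ψ x b)| ≤ C * b ^ 2 * bracket x := by
  refine ⟨(L * (K * (‖v 0‖ + K) * Real.exp (K * S) + ∫ m, a m ^ 2 ∂ν)).toNNReal,
    fun f f' hf x b hb => (hG.abs_integral_comp_sub_flow_le hv hψ hf x b).trans ?_⟩
  have hvar : 0 ≤ ∫ m, a m ^ 2 ∂ν := integral_nonneg fun m => sq_nonneg _
  rw [Real.coe_toNNReal _ (by positivity)]
  have hbracket := bracket_pos x
  calc L * (K * |v x| * Real.exp (K * |b|) + ∫ m, a m ^ 2 ∂ν) * b ^ 2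
      ≤ L * (K * ((‖v 0‖ + K) * bracket x) * Real.exp (K * S) +
          (∫ m, a m ^ 2 ∂ν) * bracket x) * b ^ 2 := by
        gcongr
        · exact norm_le_mul_bracket_of_lipschitzWith hv x
        · exact le_mul_of_one_le_right hvar (one_le_bracket x)
    _ = _ := by ring

theorem exists_abs_integral_step_sub_le {Ω : Type*} [MeasurableSpace Ω]
    (hG : IsNoisyCoeff ν G v a) (hv : LipschitzWith K v) (hψ : IsFlow v ψ)
    (P : Measure Ω) [IsProbabilityMeasure P] (L S : ℝ≥0) :
    ∃ C : ℝ≥0, ∀ f f', IsCOneOne L f f' → ∀ b : ℝ, |b| ≤ S → ∀ (X : Ω → ℝ) (γ : Ω → M),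
      Measurable X → Integrable X P → Measurable γ → HasLaw γ ν P → IndepFun X γ P →
      |∫ ω, f (X ω + G (X ω, γ ω) * b) ∂P - ∫ ω, f (ψ (X ω) b) ∂P| ≤
        C * b ^ 2 * ∫ ω, bracket (X ω) ∂P := by
  obtain ⟨C, hC⟩ := hG.exists_abs_integral_comp_sub_flow_le hv hψ L S
  refine ⟨C, fun f f' hf b hb X γ hX hXi hγ hlaw hindep => ?_⟩
  have hstep : Integrable (fun ω => f (X ω + G (X ω, γ ω) * b)) P :=
    integrable_comp_of_lipschitzWith hf.lipschitzWith
      (hXi.add ((hG.integrable_comp hv hX hXi hγ hlaw).mul_const b))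
  rw [← integral_const_mul]
  exact abs_integral_comp_sub_le_of_indepFun hX hlaw hindep
    (F := fun z => f (z.1 + G z * b)) (u := fun x => f (ψ x b))
    (hf.lipschitzWith.continuous.measurable.comp
      (measurable_fst.add (hG.measurable.mul_const b))) hstep
    (integrable_comp_of_lipschitzWith (hf.lipschitzWith.comp (hψ.lipschitzWith hv b)) hXi)
    ((integrable_comp_of_lipschitzWith isCOneOne_bracket.lipschitzWith hXi).const_mul _)
    fun x => hC f f' hf x b hb

end IsNoisyCoeff

/-! ### The weak error along a discrete path -/

theorem IsFlow.exists_integral_bracket_le {Ω : Type*} [MeasurableSpace Ω] {K : ℝ≥0} {v : ℝ → ℝ}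
    {ψ : ℝ → ℝ → ℝ} (hψ : IsFlow v ψ) (hv : LipschitzWith K v) (P : Measure Ω) [IsFiniteMeasure P]
    (S : ℝ≥0) : ∃ D : ℝ≥0, ∀ s : ℝ, |s| ≤ S → ∀ X : Ω → ℝ, Integrable X P →
      ∫ ω, bracket (X ω) ∂P ≤ D * ∫ ω, bracket (ψ (X ω) s) ∂P := by
  obtain ⟨D, hD⟩ := hψ.exists_bracket_le hv S
  refine ⟨D, fun s hs X hX => ?_⟩
  have hbracket := isCOneOne_bracket.lipschitzWith
  rw [← integral_const_mul]
  exact integral_mono (integrable_comp_of_lipschitzWith hbracket hX)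
    ((integrable_comp_of_lipschitzWith (hbracket.comp (hψ.lipschitzWith hv s)) hX).const_mul _)
    fun ω => hD s hs (X ω)

theorem le_mul_exp_sum_of_forall_lt {a c : ℕ → ℝ} {N : ℕ} (ha : 0 ≤ a 0) (hc : ∀ n, 0 ≤ c n)
    (hac : ∀ n < N, a (n + 1) ≤ (1 + c n) * a n) {n : ℕ} (hn : n ≤ N) :
    a n ≤ a 0 * Real.exp (∑ k ∈ Finset.range n, c k) := by
  induction n with
  | zero => simp
  | succ n ih =>
    calc a (n + 1) ≤ (1 + c n) * a n := hac n hn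
      _ ≤ (1 + c n) * (a 0 * Real.exp (∑ k ∈ Finset.range n, c k)) :=
        mul_le_mul_of_nonneg_left (ih (by omega)) (by linarith [hc n])
      _ ≤ Real.exp (c n) * (a 0 * Real.exp (∑ k ∈ Finset.range n, c k)) := by
        gcongr
        linarith [Real.add_one_le_exp (c n)]
      _ = a 0 * Real.exp (∑ k ∈ Finset.range (n + 1), c k) := by
        rw [Finset.sum_range_succ, Real.exp_add]
        ring

/-- The recursion `x_{n+1} = x_n + G (x_n, m_n) b_n` with increments `b` and noise `m`. -/
def scheme {M : Type*} (G : ℝ × M → ℝ) (x₀ : ℝ) (b : ℕ → ℝ) (m : ℕ → M) : ℕ → ℝ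
  | 0 => x₀
  | n + 1 => scheme G x₀ b m n + G (scheme G x₀ b m n, m n) * b n

/-- The quadratic variation up to time `N` of a path in discrete time. -/
def quadVariation (p : ℕ → ℝ) (N : ℕ) : ℝ :=
  ∑ n ∈ Finset.range N, (p (n + 1) - p n) ^ 2

/-- Independent random variables with common law `ν`. -/
structure IsIIDNoise {Ω M : Type*} [MeasurableSpace Ω] [MeasurableSpace M] (ν : Measure M)
    (γ : ℕ → Ω → M) (P : Measure Ω) : Prop where
  measurable : ∀ n, Measurable (γ n)
  iIndepFun : iIndepFun γ P
  hasLaw : ∀ n, HasLaw (γ n) ν P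

theorem measurable_scheme {α M : Type*} [MeasurableSpace α] [MeasurableSpace M] {G : ℝ × M → ℝ}
    (hG : Measurable G) (x₀ : ℝ) {b : ℕ → α → ℝ} {m : ℕ → α → M} {n : ℕ}
    (hb : ∀ k < n, Measurable (b k)) (hm : ∀ k < n, Measurable (m k)) :
    Measurable fun a => scheme G x₀ (b · a) (m · a) n := by
  induction n with
  | zero => exact measurable_const
  | succ n ih =>
    have h := ih (fun k hk => hb k (hk.trans n.lt_succ_self))
      fun k hk => hm k (hk.trans n.lt_succ_self)
    exact h.add ((hG.comp (h.prodMk (hm n n.lt_succ_self))).mul (hb n n.lt_succ_self))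

section Scheme

variable {Ω M : Type*} [MeasurableSpace Ω] [MeasurableSpace M] {P : Measure Ω} {ν : Measure M}
  {G : ℝ × M → ℝ} {v v' h h' : ℝ → ℝ} {a : M → ℝ} {γ : ℕ → Ω → M} {K L : ℝ≥0} {ψ : ℝ → ℝ → ℝ}

theorem IsIIDNoise.measurable_scheme (hγ : IsIIDNoise ν γ P) (hG : Measurable G) (x₀ : ℝ)
    (b : ℕ → ℝ) (n : ℕ) : Measurable fun ω => scheme G x₀ b (γ · ω) n :=
  FBMAveraging.measurable_scheme hG x₀ (b := fun k _ => b k) (fun _ _ => measurable_const)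
    fun k _ => hγ.measurable k

theorem IsIIDNoise.indepFun_scheme (hγ : IsIIDNoise ν γ P) (hG : Measurable G) (x₀ : ℝ)
    (b : ℕ → ℝ) (n : ℕ) : IndepFun (fun ω => scheme G x₀ b (γ · ω) n) (γ n) P := by
  have hpast : Measurable[⨆ i ∈ Set.Iio n, MeasurableSpace.comap (γ i) inferInstance]
      fun ω => scheme G x₀ b (γ · ω) n := by
    let _ : MeasurableSpace Ω := ⨆ i ∈ Set.Iio n, MeasurableSpace.comap (γ i) inferInstance
    refine FBMAveraging.measurable_scheme (b := fun k _ => b k) hG x₀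
      (fun _ _ => measurable_const) fun k hk => Measurable.of_comap_le ?_
    exact le_iSup₂_of_le (f := fun i (_ : i ∈ Set.Iio n) => MeasurableSpace.comap (γ i) _) k hk
      le_rfl
  have hindep := indep_iSup_of_disjoint (fun k => (hγ.measurable k).comap_le) hγ.iIndepFun
    (S := Set.Iio n) (T := {n}) (by simp)
  rw [iSup_singleton] at hindep
  exact (IndepFun_iff_Indep _ _ _).2 (indep_of_indep_of_le_left hindep hpast.comap_le)

variable [IsProbabilityMeasure P]

theorem IsNoisyCoeff.integrable_scheme (hG : IsNoisyCoeff ν G v a) (hv : LipschitzWith K v)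
    (hγ : IsIIDNoise ν γ P) (x₀ : ℝ) (b : ℕ → ℝ) (n : ℕ) :
    Integrable (fun ω => scheme G x₀ b (γ · ω) n) P := by
  induction n with
  | zero => exact integrable_const x₀
  | succ n ih =>
    exact ih.add ((hG.integrable_comp hv (hγ.measurable_scheme hG.measurable x₀ b n) ih
      (hγ.measurable n) (hγ.hasLaw n)).mul_const _)

variable (P) [IsProbabilityMeasure ν]

theorem IsNoisyCoeff.exists_abs_integral_flow_scheme_succ_sub_le (hG : IsNoisyCoeff ν G v a)
    (hv : IsCOneOne K v v') (hψ : IsFlow v ψ) (hh : IsCOneOne L h h') (x₀ : ℝ) (S : ℝ≥0) :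
    ∃ C : ℝ≥0, ∀ γ, IsIIDNoise ν γ P → ∀ (b : ℕ → ℝ) (n : ℕ) (s : ℝ), |b n| ≤ S → |s| ≤ S →
      |∫ ω, h (ψ (scheme G x₀ b (γ · ω) (n + 1)) s) ∂P -
          ∫ ω, h (ψ (scheme G x₀ b (γ · ω) n) (b n + s)) ∂P| ≤
        C * b n ^ 2 * ∫ ω, bracket (scheme G x₀ b (γ · ω) n) ∂P := by
  obtain ⟨L', hL'⟩ := hh.exists_comp_flow hψ hv S
  obtain ⟨C, hC⟩ := hG.exists_abs_integral_step_sub_le hv.lipschitzWith hψ P L' S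
  refine ⟨C, fun γ hγ b n s hb hs => ?_⟩
  obtain ⟨d, hd⟩ := hL' s hs
  simpa only [scheme, hψ.flow_add hv.lipschitzWith] using hC _ d hd (b n) hb _ (γ n)
    (hγ.measurable_scheme hG.measurable x₀ b n)
    (hG.integrable_scheme hv.lipschitzWith hγ x₀ b n) (hγ.measurable n) (hγ.hasLaw n)
    (hγ.indepFun_scheme hG.measurable x₀ b n)

-- Undoing the flow, `x ↦ bracket (ψ x (p 0 - p n))` is a Lyapunov function for the scheme: its
-- growth per step is of order two in the increment, although that of `bracket` is of order one.
theorem IsNoisyCoeff.exists_integral_bracket_scheme_le (hG : IsNoisyCoeff ν G v a)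
    (hv : IsCOneOne K v v') (hψ : IsFlow v ψ) (x₀ : ℝ) (S R : ℝ≥0) :
    ∃ C : ℝ, ∀ γ, IsIIDNoise ν γ P → ∀ (p : ℕ → ℝ) (N : ℕ),
      (∀ k ≤ N, ∀ n ≤ N, |p n - p k| ≤ S) → quadVariation p N ≤ R → ∀ n ≤ N,
      ∫ ω, bracket (scheme G x₀ (fun k => p (k + 1) - p k) (γ · ω) n) ∂P ≤ C := by
  obtain ⟨C, hC⟩ :=
    hG.exists_abs_integral_flow_scheme_succ_sub_le P hv hψ isCOneOne_bracket x₀ S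
  obtain ⟨D, hD⟩ := hψ.exists_integral_bracket_le hv.lipschitzWith P S
  refine ⟨D * (bracket x₀ * Real.exp (C * D * R)), fun γ hγ p N hp hR => ?_⟩
  set X : ℕ → Ω → ℝ := fun n ω => scheme G x₀ (fun k => p (k + 1) - p k) (γ · ω) n with hX
  set u : ℕ → ℝ := fun n => ∫ ω, bracket (ψ (X n ω) (p 0 - p n)) ∂P with hu
  have hXu : ∀ n ≤ N, ∫ ω, bracket (X n ω) ∂P ≤ D * u n := fun n hn =>
    hD _ (hp n hn 0 N.zero_le) _ (hG.integrable_scheme hv.lipschitzWith hγ x₀ _ n)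
  have hstep : ∀ n < N, u (n + 1) ≤ (1 + C * D * (p (n + 1) - p n) ^ 2) * u n := fun n hn => by
    have hsub := (abs_le.1 (hC γ hγ (fun k => p (k + 1) - p k) n (p 0 - p (n + 1))
      (hp n hn.le _ hn) (hp _ hn 0 N.zero_le))).2
    rw [sub_add_sub_cancel', sub_le_iff_le_add] at hsub
    calc u (n + 1) ≤ C * (p (n + 1) - p n) ^ 2 * ∫ ω, bracket (X n ω) ∂P + u n := hsub
      _ ≤ C * (p (n + 1) - p n) ^ 2 * (D * u n) + u n := by
        gcongr
        exact hXu n hn.le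
      _ = (1 + C * D * (p (n + 1) - p n) ^ 2) * u n := by ring
  have hu₀ : u 0 = bracket x₀ := by simp [hu, hX, scheme, hψ.zero]
  intro n hn
  refine (hXu n hn).trans (mul_le_mul_of_nonneg_left ?_ D.coe_nonneg)
  refine (le_mul_exp_sum_of_forall_lt (hu₀ ▸ (bracket_pos x₀).le)
    (fun k => by positivity) hstep hn).trans ?_
  rw [hu₀, ← Finset.mul_sum]
  have hbracket := bracket_pos x₀
  gcongr
  exact (Finset.sum_le_sum_of_subset_of_nonneg (Finset.range_mono hn)
    fun k _ _ => sq_nonneg _).trans hR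

theorem IsNoisyCoeff.exists_abs_integral_scheme_sub_flow_le (hG : IsNoisyCoeff ν G v a)
    (hv : IsCOneOne K v v') (hψ : IsFlow v ψ) (hh : IsCOneOne L h h') (x₀ : ℝ) (S R : ℝ≥0) :
    ∃ C : ℝ, ∀ γ, IsIIDNoise ν γ P → ∀ (p : ℕ → ℝ) (N : ℕ),
      (∀ k ≤ N, ∀ n ≤ N, |p n - p k| ≤ S) → quadVariation p N ≤ R →
      |∫ ω, h (scheme G x₀ (fun k => p (k + 1) - p k) (γ · ω) N) ∂P - h (ψ x₀ (p N - p 0))| ≤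
        C * quadVariation p N := by
  obtain ⟨C, hC⟩ := hG.exists_abs_integral_flow_scheme_succ_sub_le P hv hψ hh x₀ S
  obtain ⟨D, hD⟩ := hG.exists_integral_bracket_scheme_le P hv hψ x₀ S R
  refine ⟨C * D, fun γ hγ p N hp hR => ?_⟩
  set X : ℕ → Ω → ℝ := fun n ω => scheme G x₀ (fun k => p (k + 1) - p k) (γ · ω) n with hX
  set u : ℕ → ℝ := fun n => ∫ ω, h (ψ (X n ω) (p N - p n)) ∂P with hu
  have hstep : ∀ n < N, |u (n + 1) - u n| ≤ C * D * (p (n + 1) - p n) ^ 2 := fun n hn => by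
    have hsub := hC γ hγ (fun k => p (k + 1) - p k) n (p N - p (n + 1)) (hp n hn.le _ hn)
      (hp _ hn N le_rfl)
    rw [sub_add_sub_cancel'] at hsub
    refine hsub.trans ?_
    rw [mul_right_comm]
    gcongr
    exact hD γ hγ p N hp hR n hn.le
  have huN : u N = ∫ ω, h (X N ω) ∂P := by simp [hu, hψ.zero]
  have hu₀ : u 0 = h (ψ x₀ (p N - p 0)) := by simp [hu, hX, scheme]
  rw [← hu₀, ← huN, ← Finset.sum_range_sub, quadVariation, Finset.mul_sum]
  exact (Finset.abs_sum_le_sum_abs _ _).trans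
    (Finset.sum_le_sum fun n hn => hstep n (Finset.mem_range.1 hn))

theorem IsNoisyCoeff.exists_abs_integral_scheme_sub_scheme_le {G' : ℝ × M → ℝ} {a' : M → ℝ}
    (hG : IsNoisyCoeff ν G v a) (hG' : IsNoisyCoeff ν G' v a') (hv : IsCOneOne K v v')
    (hh : IsCOneOne L h h') (x₀ : ℝ) (S R : ℝ≥0) :
    ∃ C : ℝ, ∀ γ, IsIIDNoise ν γ P → ∀ (p : ℕ → ℝ) (N : ℕ),
      (∀ k ≤ N, ∀ n ≤ N, |p n - p k| ≤ S) → quadVariation p N ≤ R →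
      |∫ ω, h (scheme G x₀ (fun k => p (k + 1) - p k) (γ · ω) N) ∂P -
          ∫ ω, h (scheme G' x₀ (fun k => p (k + 1) - p k) (γ · ω) N) ∂P| ≤
        C * quadVariation p N := by
  obtain ⟨ψ, hψ⟩ := exists_isFlow hv.lipschitzWith hv.contDiff
  obtain ⟨C, hC⟩ := hG.exists_abs_integral_scheme_sub_flow_le P hv hψ hh x₀ S R
  obtain ⟨C', hC'⟩ := hG'.exists_abs_integral_scheme_sub_flow_le P hv hψ hh x₀ S R
  refine ⟨C + C', fun γ hγ p N hp hR => ?_⟩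
  have h₁ := hC γ hγ p N hp hR
  have h₂ := hC' γ hγ p N hp hR
  rw [abs_sub_comm] at h₂
  exact ((abs_sub_le _ _ _).trans (add_le_add h₁ h₂)).trans_eq (add_mul _ _ _).symm

end Scheme

/-! ### The schemes driven by random processes -/

section Processes

variable {Ω : Type*} (g : ℝ × ℝ → ℝ) (β B : ℝ≥0 → Ω → ℝ) (x₀ : ℝ) (Δt : ℝ≥0)

theorem limitScheme_eq_scheme (n : ℕ) (ω : Ω) : limitScheme g β B x₀ Δt n ω =
    scheme g x₀ (increment β Δt · ω) (normalizedIncrement B Δt · ω) n := by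
  induction n with
  | zero => rfl
  | succ n ih => rw [limitScheme, scheme, ih]

theorem averagedScheme_eq_scheme (m : ℕ → ℝ) (n : ℕ) (ω : Ω) : averagedScheme g β x₀ Δt n ω =
    scheme (fun z => averagedCoeff g z.1) x₀ (increment β Δt · ω) m n := by
  induction n with
  | zero => rfl
  | succ n ih => rw [averagedScheme, scheme, ih]

/-- The path of `β` sampled on the uniform grid of step `Δt`. -/
def gridPath (ω : Ω) (n : ℕ) : ℝ := β (n * Δt) ω

theorem increment_eq_gridPath_sub (ω : Ω) :
    (increment β Δt · ω) = fun n => gridPath β Δt ω (n + 1) - gridPath β Δt ω n := by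
  ext n
  simp [increment, gridPath]

/-- The quadratic variation of `β` along the first `N` cells of the uniform grid of step `Δt`. -/
def gridVariation (N : ℕ) (ω : Ω) : ℝ := quadVariation (gridPath β Δt ω) N

theorem gridVariation_eq_sum (N : ℕ) (ω : Ω) :
    gridVariation β Δt N ω = ∑ n ∈ Finset.range N, increment β Δt n ω ^ 2 := by
  simp [gridVariation, quadVariation, gridPath, increment]

variable {g β B Δt}

theorem exists_abs_gridPath_sub_le {ω : Ω} (hω : Continuous fun t => β t ω) (T : ℝ≥0) :
    ∃ S : ℝ≥0, ∀ N : ℕ, ∀ k ≤ N, ∀ n ≤ N,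
      |gridPath β (T / N) ω n - gridPath β (T / N) ω k| ≤ S := by
  obtain ⟨S, hS⟩ := Metric.isBounded_iff_nndist.1
    ((isCompact_Icc (a := (0 : ℝ≥0)) (b := T)).image hω).isBounded
  have hgrid : ∀ N n : ℕ, n ≤ N → (n : ℝ≥0) * (T / N) ∈ Set.Icc 0 T := fun N n hn => by
    refine ⟨zero_le, ?_⟩
    rw [mul_div_left_comm]
    exact mul_le_of_le_one_right zero_le (div_le_one_of_le₀ (by exact_mod_cast hn) zero_le)
  exact ⟨S, fun N k hk n hn =>
    hS (Set.mem_image_of_mem _ (hgrid N n hn)) (Set.mem_image_of_mem _ (hgrid N k hk))⟩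

variable [MeasurableSpace Ω]

theorem measurable_increment (hβ : ∀ t, Measurable (β t)) (n : ℕ) :
    Measurable (increment β Δt n) :=
  (hβ _).sub (hβ _)

theorem measurable_normalizedIncrement (hB : ∀ t, Measurable (B t)) (n : ℕ) :
    Measurable (normalizedIncrement B Δt n) :=
  (measurable_increment hB n).const_mul _

theorem measurable_averagedCoeff (hg : Measurable g) : Measurable (averagedCoeff g) :=
  hg.stronglyMeasurable.integral_prod_right'.measurable

theorem measurable_averagedScheme (hg : Measurable g) (hβ : ∀ t, Measurable (β t)) (n : ℕ) :
    Measurable (averagedScheme g β x₀ Δt n) := by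
  rw [funext (averagedScheme_eq_scheme g β x₀ Δt (fun _ => 0) n)]
  exact measurable_scheme ((measurable_averagedCoeff hg).comp measurable_fst) x₀
    (b := increment β Δt) (fun k _ => measurable_increment hβ k) fun _ _ => measurable_const

theorem isIIDNoise_normalizedIncrement {P : Measure Ω} (hB : IsPreBrownianReal B P)
    (hBm : ∀ t, Measurable (B t)) (hΔt : 0 < Δt) :
    IsIIDNoise (gaussianReal 0 1) (normalizedIncrement B Δt) P where
  measurable := measurable_normalizedIncrement hBm
  iIndepFun := by
    have hgrid : Monotone fun n : ℕ => (n : ℝ≥0) * Δt :=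
      Nat.mono_cast.mul_const zero_le
    have hincrement : iIndepFun (increment B Δt) P := by
      simpa only [increment, Nat.cast_succ] using! hB.hasIndepIncrements.nat hgrid
    exact hincrement.comp (fun _ x => (√(Δt : ℝ))⁻¹ * x) fun _ => measurable_const_mul _
  hasLaw n := by
    have hdist : nndist ((n + 1) * Δt : ℝ≥0).1 (n * Δt : ℝ≥0).1 = Δt := by
      ext
      simp only [coe_nndist, Real.dist_eq, NNReal.val_eq_coe]
      push_cast
      rw [add_mul, one_mul, add_sub_cancel_left, abs_of_nonneg Δt.coe_nonneg]
    have hlaw : HasLaw (increment B Δt n) (gaussianReal 0 Δt) P := by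
      have hsub := hB.hasLaw_sub ((n + 1) * Δt) (n * Δt)
      rwa [hdist] at hsub
    convert! gaussianReal_const_mul hlaw (√(Δt : ℝ))⁻¹ using 2
    · simp
    · ext
      simp [inv_pow, hΔt.ne']

end Processes

/-! ### Conditioning on an independent process -/

theorem condExp_comp_ae_eq_integral_of_indepFun {Ω E F : Type*} [MeasurableSpace Ω]
    {P : Measure Ω} [IsProbabilityMeasure P] [mE : MeasurableSpace E] [MeasurableSpace F]
    [StandardBorelSpace F] [Nonempty F] {U : Ω → E} {V : Ω → F} (hU : Measurable U)
    (hV : Measurable V) (hindep : IndepFun U V P) {f : E × F → ℝ} (hf : Measurable f)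
    (hi : Integrable (fun ω => f (U ω, V ω)) P) :
    P[fun ω => f (U ω, V ω) | mE.comap U] =ᵐ[P] fun ω => ∫ ω', f (U ω, V ω') ∂P := by
  have : IsProbabilityMeasure (P.map V) := Measure.isProbabilityMeasure_map hV.aemeasurable
  have hconst : condDistrib V U P =ᵐ[P.map U] Kernel.const E (P.map V) := by
    refine condDistrib_ae_eq_of_measure_eq_compProd U hV.aemeasurable ?_
    rw [Measure.compProd_const]
    exact (indepFun_iff_map_prod_eq_prod_map_map hU.aemeasurable hV.aemeasurable).1 hindep
  filter_upwards [condExp_prod_ae_eq_integral_condDistrib hU hV.aemeasurable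
    hf.stronglyMeasurable hi, ae_of_ae_map hU.aemeasurable hconst] with ω hcond hω
  rw [hcond, hω, Kernel.const_apply]
  exact integral_map hV.aemeasurable (hf.comp measurable_prodMk_left).aestronglyMeasurable

theorem generatedSigma_eq_comap {Ω : Type*} (β : ℝ≥0 → Ω → ℝ) :
    generatedSigma β = MeasurableSpace.comap (fun ω t => β t ω) MeasurableSpace.pi := by
  simp only [MeasurableSpace.pi, MeasurableSpace.comap_iSup, MeasurableSpace.comap_comp]
  rfl

theorem condExp_limitScheme_ae_eq {Ω : Type*} [MeasurableSpace Ω] {P : Measure Ω}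
    [IsProbabilityMeasure P] {β B : ℝ≥0 → Ω → ℝ} (hβ : ∀ t, Measurable (β t))
    (hB : ∀ t, Measurable (B t)) (hindep : IndepFun (fun ω t => β t ω) (fun ω t => B t ω) P)
    {g : ℝ × ℝ → ℝ} (hg : Measurable g) (x₀ : ℝ) (Δt : ℝ≥0) (N : ℕ) {φ : ℝ → ℝ}
    (hφ : Measurable φ) {c : ℝ} (hc : ∀ x, |φ x| ≤ c) :
    P[fun ω => φ (limitScheme g β B x₀ Δt N ω) | generatedSigma β] =ᵐ[P] fun ω =>
      ∫ ω', φ (scheme g x₀ (increment β Δt · ω) (normalizedIncrement B Δt · ω') N) ∂P := by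
  let X : ℝ≥0 → (ℝ≥0 → ℝ) → ℝ := fun t p => p t
  have hX : ∀ t, Measurable (X t) := measurable_pi_apply
  let f : (ℝ≥0 → ℝ) × (ℕ → ℝ) → ℝ := fun z => φ (scheme g x₀ (increment X Δt · z.1) z.2 N)
  have hf : Measurable f := hφ.comp (measurable_scheme hg x₀
    (b := fun k (z : (ℝ≥0 → ℝ) × (ℕ → ℝ)) => increment X Δt k z.1)
    (m := fun k z => z.2 k)
    (fun k _ => (measurable_increment hX k).comp measurable_fst)
    fun k _ => (measurable_pi_apply k).comp measurable_snd)
  have hU : Measurable fun ω t => β t ω := measurable_pi_lambda _ hβ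
  have hV : Measurable fun ω k => normalizedIncrement B Δt k ω :=
    measurable_pi_lambda _ (measurable_normalizedIncrement hB)
  have hUV : IndepFun (fun ω t => β t ω) (fun ω k => normalizedIncrement B Δt k ω) P :=
    hindep.comp measurable_id (measurable_pi_lambda _ (measurable_normalizedIncrement hX))
  simp only [generatedSigma_eq_comap, limitScheme_eq_scheme]
  exact condExp_comp_ae_eq_integral_of_indepFun hU hV hUV hf
    (Integrable.of_bound (hf.comp (hU.prodMk hV)).aestronglyMeasurable c
      (ae_of_all _ fun ω => hc _))

/-! ### Quadratic variation of the fractional Brownian motion -/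

namespace IsFractionalBrownian

variable {Ω : Type*} [MeasurableSpace Ω] {P : Measure Ω} {β : ℝ≥0 → Ω → ℝ} {H : ℝ}

theorem memLp_two (hβ : IsFractionalBrownian H β P) (t : ℝ≥0) : MemLp (β t) 2 P :=
  (hβ.gaussian.hasGaussianLaw_eval t).memLp_two

theorem integrable_increment_sq (hβ : IsFractionalBrownian H β P) (Δt : ℝ≥0) (n : ℕ) :
    Integrable (fun ω => increment β Δt n ω ^ 2) P :=
  ((hβ.memLp_two _).sub (hβ.memLp_two _)).integrable_sq

theorem integrable_gridVariation (hβ : IsFractionalBrownian H β P) (Δt : ℝ≥0) (N : ℕ) :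
    Integrable (gridVariation β Δt N) P := by
  simp only [funext (gridVariation_eq_sum β Δt N)]
  exact integrable_finsetSum _ fun n _ => hβ.integrable_increment_sq Δt n

theorem variance_eq (hβ : IsFractionalBrownian H β P) (hH : 0 < H) (t : ℝ≥0) :
    variance (β t) P = (t : ℝ) ^ (2 * H) := by
  rw [← covariance_self (hβ.measurable t).aemeasurable, hβ.covariance_eq, sub_self, abs_zero,
    Real.zero_rpow (by positivity)]
  ring

variable [IsProbabilityMeasure P]

theorem integral_sub_sq (hβ : IsFractionalBrownian H β P) (hH : 0 < H) (s t : ℝ≥0) :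
    ∫ ω, (β t ω - β s ω) ^ 2 ∂P = |(t : ℝ) - s| ^ (2 * H) := by
  have hcentered : ∫ ω, (β t ω - β s ω) ∂P = 0 := by
    rw [integral_sub ((hβ.memLp_two t).integrable one_le_two)
      ((hβ.memLp_two s).integrable one_le_two), hβ.centered, hβ.centered, sub_zero]
  rw [← variance_of_integral_eq_zero (X := fun ω => β t ω - β s ω)
    ((hβ.measurable t).sub (hβ.measurable s)).aemeasurable hcentered,
    variance_fun_sub (hβ.memLp_two t) (hβ.memLp_two s), hβ.variance_eq hH, hβ.variance_eq hH,
    hβ.covariance_eq, abs_sub_comm]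
  ring

theorem integral_gridVariation (hβ : IsFractionalBrownian H β P) (hH : 0 < H) (Δt : ℝ≥0)
    (N : ℕ) : ∫ ω, gridVariation β Δt N ω ∂P = N * (Δt : ℝ) ^ (2 * H) := by
  have hcell : ∀ n : ℕ, ∫ ω, increment β Δt n ω ^ 2 ∂P = (Δt : ℝ) ^ (2 * H) := fun n => by
    simp only [increment]
    rw [hβ.integral_sub_sq hH]
    push_cast
    rw [add_mul, one_mul, add_sub_cancel_left, abs_of_nonneg Δt.coe_nonneg]
  simp only [gridVariation_eq_sum]
  rw [integral_finsetSum _ fun n _ => hβ.integrable_increment_sq Δt n]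
  simp [hcell]

end IsFractionalBrownian

theorem tendsto_nat_mul_div_rpow {s : ℝ} (hs : 1 < s) {T : ℝ} (hT : 0 ≤ T) :
    Tendsto (fun N : ℕ => (N : ℝ) * (T / N) ^ s) atTop (𝓝 0) := by
  have hpow : Tendsto (fun N : ℕ => T ^ s * (N : ℝ) ^ (-(s - 1))) atTop (𝓝 0) := by
    simpa only [mul_zero, Function.comp_def] using ((tendsto_rpow_neg_atTop (sub_pos.2 hs)).comp
      tendsto_natCast_atTop_atTop).const_mul (T ^ s)
  refine hpow.congr' ?_
  filter_upwards [eventually_gt_atTop 0] with N hN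
  have hN' : (0 : ℝ) < N := by exact_mod_cast hN
  rw [Real.div_rpow hT hN'.le, neg_sub, Real.rpow_sub hN', Real.rpow_one]
  ring

theorem IsFractionalBrownian.tendstoInMeasure_gridVariation {Ω : Type*} [MeasurableSpace Ω]
    {P : Measure Ω} [IsProbabilityMeasure P] {β : ℝ≥0 → Ω → ℝ} {H : ℝ} (hH : 1 / 2 < H)
    (hβ : IsFractionalBrownian H β P) (T : ℝ≥0) :
    TendstoInMeasure P (fun N : ℕ => gridVariation β (T / N) N) atTop 0 := by
  refine tendstoInMeasure_of_tendsto_eLpNorm one_ne_zero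
    (fun N => (hβ.integrable_gridVariation _ N).aestronglyMeasurable)
    aestronglyMeasurable_const ?_
  have hnorm : ∀ N : ℕ, eLpNorm (gridVariation β (T / N) N - 0) 1 P =
      ENNReal.ofReal (N * ((T : ℝ) / N) ^ (2 * H)) := fun N => by
    have hnonneg : ∀ ω, ‖gridVariation β (T / N) N ω‖ = gridVariation β (T / N) N ω := fun ω =>
      Real.norm_of_nonneg <| by rw [gridVariation_eq_sum]; positivity
    rw [sub_zero, eLpNorm_one_eq_lintegral_enorm,
      ← ofReal_integral_norm_eq_lintegral_enorm (hβ.integrable_gridVariation _ N)]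
    simp only [hnonneg, hβ.integral_gridVariation (by linarith), NNReal.coe_div,
      NNReal.coe_natCast]
  simp only [hnorm]
  simpa using ENNReal.tendsto_ofReal
    (tendsto_nat_mul_div_rpow (by linarith : 1 < 2 * H) T.coe_nonneg)

/-! ### Convergence of the averaged scheme -/

theorem exists_abs_integral_scheme_sub_averagedScheme_le {Ω : Type*} [MeasurableSpace Ω]
    {P : Measure Ω} [IsProbabilityMeasure P] {β B : ℝ≥0 → Ω → ℝ} (hB : IsPreBrownianReal B P)
    (hBm : ∀ t, Measurable (B t)) {g : ℝ × ℝ → ℝ} (hg : HasBoundedDerivs 2 g) (x₀ : ℝ) {T : ℝ≥0}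
    (hT : 0 < T) {φ : ℝ → ℝ} (hφ : IsCb 2 φ) {ω : Ω} (hω : Continuous fun t => β t ω) :
    ∃ C : ℝ, ∀ N : ℕ, 0 < N → gridVariation β (T / N) N ω ≤ 1 →
      |∫ ω', φ (scheme g x₀ (increment β (T / N) · ω) (normalizedIncrement B (T / N) · ω') N) ∂P -
          φ (averagedScheme g β x₀ (T / N) N ω)| ≤ C * gridVariation β (T / N) N ω := by
  obtain ⟨K, hK, -⟩ := hg.exists_lipschitzWith
  have hnoisy := isNoisyCoeff_of_lipschitzWith (memLp_id_gaussianReal (μ := 0) (v := 1) 2) hK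
  obtain ⟨K', v', hv⟩ := hg.exists_isCOneOne_integral hnoisy.integrable
  obtain ⟨L, φ', hφ'⟩ := hφ.exists_isCOneOne
  obtain ⟨S, hS⟩ := exists_abs_gridPath_sub_le hω T
  obtain ⟨C, hC⟩ := hnoisy.exists_abs_integral_scheme_sub_scheme_le P
    (isNoisyCoeff_comp_fst hv.lipschitzWith.continuous.measurable) hv hφ' x₀ S 1
  refine ⟨C, fun N hN hvar => ?_⟩
  have hΔt : 0 < T / N := by positivity
  have hbound := hC _ (isIIDNoise_normalizedIncrement hB hBm hΔt) (gridPath β (T / N) ω) N (hS N)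
    (by exact_mod_cast hvar)
  have haveraged : ∀ ω', scheme (fun z => ∫ m, g (z.1, m) ∂gaussianReal 0 1) x₀
      (increment β (T / N) · ω) (normalizedIncrement B (T / N) · ω') N =
      averagedScheme g β x₀ (T / N) N ω :=
    fun ω' => (averagedScheme_eq_scheme g β x₀ _ _ N ω).symm
  rw [← increment_eq_gridPath_sub] at hbound
  simpa only [haveraged, integral_const, probReal_univ, one_smul] using! hbound

theorem tendsto_integral_zero_of_tendstoInMeasure {Ω ι E : Type*} [MeasurableSpace Ω]
    {P : Measure Ω} [IsFiniteMeasure P] [NormedAddCommGroup E] [NormedSpace ℝ E] {l : Filter ι}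
    [l.IsCountablyGenerated] {V : ι → Ω → ℝ} (hV : TendstoInMeasure P V l 0) {F : ι → Ω → E}
    (hF : ∀ n, AEStronglyMeasurable (F n) P) {c : ℝ} (hc : ∀ n, ∀ᵐ ω ∂P, ‖F n ω‖ ≤ c)
    (hFV : ∀ᵐ ω ∂P, ∃ C : ℝ, ∀ᶠ n in l, V n ω ≤ 1 → ‖F n ω‖ ≤ C * V n ω) :
    Tendsto (fun n => ∫ ω, F n ω ∂P) l (𝓝 0) := by
  refine tendsto_of_subseq_tendsto fun ns hns => ?_
  obtain ⟨ms, hms, hlim⟩ := (hV.comp hns).exists_seq_tendsto_ae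
  refine ⟨ms, ?_⟩
  rw [← integral_zero Ω E (μ := P)]
  refine tendsto_integral_of_dominated_convergence (fun _ => c) (fun k => hF _)
    (integrable_const c) (fun k => hc _) ?_
  filter_upwards [hlim, hFV] with ω hVω ⟨C, hC⟩
  have hsmall : ∀ᶠ k in atTop, V (ns (ms k)) ω ≤ 1 := hVω.eventually_le_const one_pos
  refine squeeze_zero_norm' ?_ (by simpa using hVω.const_mul C)
  filter_upwards [(hns.comp hms.tendsto_atTop).eventually hC, hsmall] with k hk hle
  exact hk hle

end FBMAveraging

end

open FBMAveraging in
theorem proposition1_general {Ω : Type*} [MeasurableSpace Ω] (P : Measure Ω)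
    [IsProbabilityMeasure P] {β B : ℝ≥0 → Ω → ℝ} (hβm : ∀ t, Measurable (β t))
    (hβc : ∀ᵐ ω ∂P, Continuous fun t => β t ω) (hB : IsPreBrownianReal B P)
    (hBm : ∀ t, Measurable (B t))
    (hindep : IndepFun (fun ω t => β t ω) (fun ω t => B t ω) P) {g : ℝ × ℝ → ℝ}
    (hg : HasBoundedDerivs 2 g) (x₀ : ℝ) {T : ℝ≥0} (hT : 0 < T)
    (hβV : TendstoInMeasure P (fun N : ℕ => gridVariation β (T / N) N) atTop 0)
    {φ : ℝ → ℝ} (hφ : IsCb 2 φ) :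
    Tendsto (fun N : ℕ => ∫ ω, |(P[fun ω' => φ (limitScheme g β B x₀ (T / N) N ω') |
      generatedSigma β]) ω - φ (averagedScheme g β x₀ (T / N) N ω)| ∂P) atTop (𝓝 0) := by
  obtain ⟨c, hc⟩ : ∃ c, ∀ x, |φ x| ≤ c := by simpa using hφ.2 0 (Nat.zero_le 2)
  have hgm : Measurable g := hg.1.continuous.measurable
  have hφm : Measurable φ := hφ.1.continuous.measurable
  have hcond := fun N : ℕ => condExp_limitScheme_ae_eq hβm hBm hindep hgm x₀ (T / N) N hφm hc
  refine tendsto_integral_zero_of_tendstoInMeasure hβV (c := c + c) (fun N => ?_) (fun N => ?_) ?_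
  · exact (integrable_condExp.aestronglyMeasurable.sub
      (hφm.comp (measurable_averagedScheme x₀ hgm hβm N)).aestronglyMeasurable).norm
  · filter_upwards [ae_bdd_abs_condExp_of_ae_bdd_abs (m := generatedSigma β)
      (ae_of_all P fun ω => hc (limitScheme g β B x₀ (T / N) N ω))] with ω hω
    rw [Real.norm_eq_abs, abs_abs]
    exact (abs_sub _ _).trans (add_le_add hω (hc _))
  · filter_upwards [hβc, ae_all_iff.2 hcond] with ω hω hcondω
    obtain ⟨C, hC⟩ := exists_abs_integral_scheme_sub_averagedScheme_le hB hBm hg x₀ hT hφ hω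
    refine ⟨C, (eventually_gt_atTop 0).mono fun N hN hvar => ?_⟩
    rw [Real.norm_eq_abs, abs_abs, hcondω N]
    exact hC N hN hvar

theorem proposition1 {Ω : Type*} [MeasurableSpace Ω] (P : Measure Ω) [IsProbabilityMeasure P]
    (H : ℝ) (hH : 1 / 2 < H) (hH1 : H < 1)
    (β B : ℝ≥0 → Ω → ℝ)
    (hβ : FBMAveraging.IsFractionalBrownian H β P)
    (hB : IsBrownianReal B P) (hBm : ∀ t, Measurable (B t))
    (hindep : IndepFun (fun ω t => β t ω) (fun ω t => B t ω) P)
    (g : ℝ × ℝ → ℝ) (hg : FBMAveraging.IsAdmissibleCoeff g)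
    (x₀ : ℝ) (T : ℝ≥0) (hT : 0 < T)
    (φ : ℝ → ℝ) (hφ : FBMAveraging.IsCb 3 φ) :
    Tendsto
      (fun N : ℕ => ∫ ω,
        |(P[fun ω' => φ (FBMAveraging.limitScheme g β B x₀ (T / N) N ω') |
            FBMAveraging.generatedSigma β]) ω
          - φ (FBMAveraging.averagedScheme g β x₀ (T / N) N ω)| ∂P)
      atTop (𝓝 0) :=
  proposition1_general P hβ.measurable hβ.cont hB.toIsPreBrownianReal hBm hindep
    (FBMAveraging.HasBoundedDerivs.mono hg (by norm_num)) x₀ hT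
    (hβ.tendstoInMeasure_gridVariation hH T) (hφ.mono (by norm_num))
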